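/- Let $\mathbb F$ be $\mathbb R$ or $\mathbb C$, let $d\ge 0$, let $n_k,m_k\ge 0$ for $k=1,\dots,d$, and let $\mathcal X=\bigoplus_{k=1}^d\mathbb F^{n_k m_k}$. All spaces below are finite-dimensional Euclidean spaces over $\mathbb F$, and $M>0$, $M<0$ mean that $M$ is (Hermitian and) strictly positive, respectively negative, definite. Let $$\boldsymbol\Delta=\{\operatorname{diag}(\Delta_1^0\otimes I_{n_1},\dots,\Delta_d^0\otimes I_{n_d}) : \Delta_k^0\in\mathbb C^{m_k\times m_k}\},$$ and for any such structure let $\mathcal D_{\boldsymbol\Delta}$ be the set of square matrices over $\mathbb F$ that commute with every $\Delta\in\boldsymbol\Delta$. A square matrix $A$ over $\mathbb F$ is called *$\mathcal Q$-stable* with respect to $\boldsymbol\Delta$ if there is an invertible $Q\in\mathcal D_{\boldsymbol\Delta}$ with $\|Q^{-1}AQ\|<1$ in operator norm. Let $$\begin{bmatrix}A&B_1&B_2\\ C_1&D_{11}&D_{12}\\ C_2&D_{21}&D_{22}\end{bmatrix}:\mathcal X\oplus\mathcal U_1\oplus\mathcal U_2\to\mathcal X\oplus\mathcal Y_1\oplus\mathcal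 Y_2$$ be a plant. A controller with multiplicities $n_{K1},\dots,n_{Kd}\ge 0$ is a matrix $$\begin{bmatrix}A_K&B_K\\ C_K&D_K\end{bmatrix}:\mathcal X_K\oplus\mathcal Y_2\to\mathcal X_K\oplus\mathcal U_2,\qquad \mathcal X_K=\bigoplus_{k=1}^d\mathbb F^{n_{Kk}m_k}.$$ The loop is well posed if $I-D_{22}D_K$ is invertible (automatic when $D_{22}=0$). In that case the closed-loop system matrix is $$\begin{bmatrix}A_{cl}&B_{cl}\\ C_{cl}&D_{cl}\end{bmatrix}=\mathcal F_\ell\left(\left[\begin{array}{ccc|cc}A&0&B_1&0&B_2\\0&0&0&I&0\\ C_1&0&D_{11}&0&D_{12}\\ \hline 0&I&0&0&0\\ C_2&0&D_{21}&0&D_{22}\end{array}\right],\begin{bmatrix}A_K&B_K\\ C_K&D_K\end{bmatrix}\right),$$ where $$\mathcal F_\ell\left(\begin{bmatrix}a&b\\c&e\end{bmatrix},\Delta'\right)=a+b(I-\Delta' e)^{-1}\Delta' c.$$ If $D_{22}=0$ this gives $A_{cl}=\begin{bmatrix}A+B_2D_KC_2&B_2C_K\\ B_KC_2&A_K\end{bmatrix}$.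 The controller *achieves $\mathcal Q$-stability* if the loop is well posed and $A_{cl}$, acting on $\mathcal X\oplus\mathcal X_K$, is $\mathcal Q$-stable with respect to the coupled structure $$\boldsymbol\Delta_{cl}=\{\operatorname{diag}(\Delta_1^0\otimes I_{n_1},\dots,\Delta_d^0\otimes I_{n_d},\Delta_1^0\otimes I_{n_{K1}},\dots,\Delta_d^0\otimes I_{n_{Kd}}):\Delta_k^0\in\mathbb C^{m_k\times m_k}\}.$$ **(1)** Let $B_\perp$ and $C_\perp$ be any matrices such that $B_\perp$ is injective with $\operatorname{Im}B_\perp=\operatorname{Ker}B_2^*$, and $C_\perp^*$ is injective with $\operatorname{Im}C_\perp^*=\operatorname{Ker}C_2$. There is a static output feedback controller (all $n_{Kk}=0$) that achieves $\mathcal Q$-stability if and only if there is a positive definite $X\in\mathcal D_{\boldsymbol\Delta}$ with $$B_\perp^*AX^{-1}A^*B_\perp-B_\perp^*X^{-1}B_\perp<0,\qquad C_\perp A^*XAC_\perp^*-C_\perp XC_\perp^*<0.$$ **(2)** There are multiplicities $n_{K1},\dots,n_{Kd}\ge 0$ (with no restriction) and a controller with these multiplicities that achieves $\mathcal Q$-stability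 if and only if there are positive definite $X,Y\in\mathcal D_{\boldsymbol\Delta}$ with $$AYA^*-Y-B_2B_2^*<0,\qquad A^*XA-X-C_2^*C_2<0.$$ -/

import Mathlib

open scoped Matrix Kronecker ComplexOrder

/-- Coordinates of `⊕ₖ 𝔽^(nₖ · mₖ)`: the coordinate `⟨k, (i, a)⟩` is entry `a` of the `i`-th of the
`mₖ` consecutive sub-blocks, each of size `nₖ`, of the `k`-th summand. -/
abbrev StateIdx {d : ℕ} (n m : Fin d → ℕ) : Type :=
  (k : Fin d) × (Fin (m k) × Fin (n k))

/-- The block-diagonal matrix with diagonal blocks `Δ⁰ₖ ⊗ I_{nₖ}`. -/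
def uncertaintyBlock {d : ℕ} (n m : Fin d → ℕ) (δ : (k : Fin d) → Matrix (Fin (m k)) (Fin (m k)) ℂ) :
    Matrix (StateIdx n m) (StateIdx n m) ℂ :=
  Matrix.blockDiagonal' fun k => δ k ⊗ₖ (1 : Matrix (Fin (n k)) (Fin (n k)) ℂ)

/-- The uncertainty structure `𝚫`, the entries of the `Δ⁰ₖ` being arbitrary complex numbers. -/
def uncertaintyStructure {d : ℕ} (n m : Fin d → ℕ) :
    Set (Matrix (StateIdx n m) (StateIdx n m) ℂ) :=
  Set.range (uncertaintyBlock n m)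

/-- The coupled closed-loop structure `𝚫_cl`: the same matrices `Δ⁰ₖ` appear in the plant part (with
multiplicity `nₖ`) and in the controller part (with multiplicity `n_{Kk}`). -/
def coupledStructure {d : ℕ} (n nK m : Fin d → ℕ) :
    Set (Matrix (StateIdx n m ⊕ StateIdx nK m) (StateIdx n m ⊕ StateIdx nK m) ℂ) :=
  Set.range fun δ => Matrix.fromBlocks (uncertaintyBlock n m δ) 0 0 (uncertaintyBlock nK m δ)

/-- The commutant `𝓓_𝚫`: matrices over `𝕜` (`ℝ` or `ℂ`) which, regarded as complex matrices through
the inclusion of `𝕜` in `ℂ`, commute with all elements of `𝚫`. -/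
def commutant (𝕜 : Type*) [RCLike 𝕜] {ι : Type*} [Fintype ι] (S : Set (Matrix ι ι ℂ)) :
    Set (Matrix ι ι 𝕜) :=
  {Q | ∀ Δ ∈ S, Q.map (RCLike.map 𝕜 ℂ) * Δ = Δ * Q.map (RCLike.map 𝕜 ℂ)}

/-- `𝓠`-stability of the state matrix `A` with respect to `𝚫`: some invertible `Q ∈ 𝓓_𝚫` satisfies
`‖Q⁻¹ A Q‖ < 1`, in the operator norm induced by the Euclidean norm. -/
def IsQStable {𝕜 : Type*} [RCLike 𝕜] {ι : Type*} [Fintype ι] [DecidableEq ι]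
    (A : Matrix ι ι 𝕜) (S : Set (Matrix ι ι ℂ)) : Prop :=
  ∃ Q ∈ commutant 𝕜 S, IsUnit Q ∧ ‖Matrix.toEuclideanCLM (𝕜 := 𝕜) (n := ι) (Q⁻¹ * A * Q)‖ < 1

/-- The lower linear fractional transformation
`𝓕_ℓ([A B; C D], Δ') = A + B (I - Δ' D)⁻¹ Δ' C`. -/
noncomputable def lowerLFT {𝕜 : Type*} [RCLike 𝕜] {r s a b : Type*}
    [Fintype a] [Fintype b] [DecidableEq b]
    (A : Matrix r s 𝕜) (B : Matrix r b 𝕜) (C : Matrix a s 𝕜) (D : Matrix a b 𝕜)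
    (Δ' : Matrix b a 𝕜) : Matrix r s 𝕜 :=
  A + B * (1 - Δ' * D)⁻¹ * Δ' * C

/-- The plant: a system matrix `[A B₁ B₂; C₁ D₁₁ D₁₂; C₂ D₂₁ D₂₂]` with state space
`⊕ₖ 𝕜^(nₖ · mₖ)`, disturbance, control, error and measurement spaces of dimensions
`u₁, u₂, y₁, y₂`. -/
structure LFTPlant (𝕜 : Type*) [RCLike 𝕜] {d : ℕ} (n m : Fin d → ℕ) (u₁ u₂ y₁ y₂ : ℕ) where
  A : Matrix (StateIdx n m) (StateIdx n m) 𝕜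
  B₁ : Matrix (StateIdx n m) (Fin u₁) 𝕜
  B₂ : Matrix (StateIdx n m) (Fin u₂) 𝕜
  C₁ : Matrix (Fin y₁) (StateIdx n m) 𝕜
  C₂ : Matrix (Fin y₂) (StateIdx n m) 𝕜
  D₁₁ : Matrix (Fin y₁) (Fin u₁) 𝕜
  D₁₂ : Matrix (Fin y₁) (Fin u₂) 𝕜
  D₂₁ : Matrix (Fin y₂) (Fin u₁) 𝕜
  D₂₂ : Matrix (Fin y₂) (Fin u₂) 𝕜

/-- The controller: a system matrix `[A_K B_K; C_K D_K]` with state space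
`⊕ₖ 𝕜^(n_{Kk} · mₖ)`, from measurements to controls. -/
structure LFTController (𝕜 : Type*) [RCLike 𝕜] {d : ℕ} (nK m : Fin d → ℕ) (u₂ y₂ : ℕ) where
  A : Matrix (StateIdx nK m) (StateIdx nK m) 𝕜
  B : Matrix (StateIdx nK m) (Fin y₂) 𝕜
  C : Matrix (Fin u₂) (StateIdx nK m) 𝕜
  D : Matrix (Fin u₂) (Fin y₂) 𝕜

namespace LFTPlant

variable {𝕜 : Type*} [RCLike 𝕜] {d : ℕ} {n nK m : Fin d → ℕ} {u₁ u₂ y₁ y₂ : ℕ}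

/-- Well-posedness of the feedback loop. -/
def WellPosed (P : LFTPlant 𝕜 n m u₁ u₂ y₁ y₂) (K : LFTController 𝕜 nK m u₂ y₂) : Prop :=
  IsUnit (1 - P.D₂₂ * K.D)

/-- The closed-loop system matrix `[A_cl B_cl; C_cl D_cl]`, the lower linear fractional
transformation with load `[A_K B_K; C_K D_K]` and symbol
`[A 0 B₁ | 0 B₂; 0 0 0 | I 0; C₁ 0 D₁₁ | 0 D₁₂; 0 I 0 | 0 0; C₂ 0 D₂₁ | 0 D₂₂]`. -/
noncomputable def closedLoop (P : LFTPlant 𝕜 n m u₁ u₂ y₁ y₂) (K : LFTController 𝕜 nK m u₂ y₂) :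
    Matrix ((StateIdx n m ⊕ StateIdx nK m) ⊕ Fin y₁) ((StateIdx n m ⊕ StateIdx nK m) ⊕ Fin u₁) 𝕜 :=
  lowerLFT
    (Matrix.fromBlocks (Matrix.fromBlocks P.A 0 0 0) (Matrix.fromRows P.B₁ 0)
      (Matrix.fromCols P.C₁ 0) P.D₁₁)
    (Matrix.fromRows (Matrix.fromBlocks 0 P.B₂ 1 0) (Matrix.fromCols 0 P.D₁₂))
    (Matrix.fromCols (Matrix.fromBlocks 0 1 P.C₂ 0) (Matrix.fromRows 0 P.D₂₁))
    (Matrix.fromBlocks 0 0 0 P.D₂₂)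
    (Matrix.fromBlocks K.A K.B K.C K.D)

/-- The closed-loop state matrix `A_cl`. -/
noncomputable def closedLoopA (P : LFTPlant 𝕜 n m u₁ u₂ y₁ y₂)
    (K : LFTController 𝕜 nK m u₂ y₂) :
    Matrix (StateIdx n m ⊕ StateIdx nK m) (StateIdx n m ⊕ StateIdx nK m) 𝕜 :=
  (P.closedLoop K).toBlocks₁₁

/-- The controller `K` achieves `𝓠`-stability: the loop is well posed and `A_cl` is `𝓠`-stable with
respect to the coupled structure `𝚫_cl`. -/
def IsQStabilizedBy (P : LFTPlant 𝕜 n m u₁ u₂ y₁ y₂) (K : LFTController 𝕜 nK m u₂ y₂) : Prop :=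
  P.WellPosed K ∧ IsQStable (P.closedLoopA K) (coupledStructure n nK m)

/-- When `D₂₂ = 0` the closed-loop system matrix has the usual explicit form. -/
theorem closedLoop_of_D₂₂_eq_zero (P : LFTPlant 𝕜 n m u₁ u₂ y₁ y₂)
    (K : LFTController 𝕜 nK m u₂ y₂) (h : P.D₂₂ = 0) :
    P.closedLoop K =
      Matrix.fromBlocks
        (Matrix.fromBlocks (P.A + P.B₂ * K.D * P.C₂) (P.B₂ * K.C) (K.B * P.C₂) K.A)
        (Matrix.fromRows (P.B₁ + P.B₂ * K.D * P.D₂₁) (K.B * P.D₂₁))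
        (Matrix.fromCols (P.C₁ + P.D₁₂ * K.D * P.C₂) (P.D₁₂ * K.C))
        (P.D₁₁ + P.D₁₂ * K.D * P.D₂₁) := by
  simp only [closedLoop, lowerLFT, h, Matrix.fromBlocks_zero, Matrix.mul_zero, sub_zero, inv_one,
    Matrix.mul_one]
  ext ((x | x) | x) ((y | y) | y) <;>
    simp [Matrix.mul_apply, Matrix.mul_assoc, Matrix.one_apply, Finset.mul_sum]


end LFTPlant

/-- The explicit form of the commutant: `Q = diag(Q₁, …, Q_d)` with
`Qₖ = diag(Q_{k,0}, …, Q_{k,0})`. -/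
theorem mem_commutant_uncertaintyStructure_iff {𝕜 : Type*} [RCLike 𝕜] {d : ℕ} (n m : Fin d → ℕ)
    (Q : Matrix (StateIdx n m) (StateIdx n m) 𝕜) :
    Q ∈ commutant 𝕜 (uncertaintyStructure n m) ↔
      ∃ Q₀ : (k : Fin d) → Matrix (Fin (n k)) (Fin (n k)) 𝕜,
        Q = Matrix.blockDiagonal' fun k => (1 : Matrix (Fin (m k)) (Fin (m k)) 𝕜) ⊗ₖ Q₀ k := by
  have f0 : RCLike.map 𝕜 ℂ 0 = 0 := map_zero _
  have f1 : RCLike.map 𝕜 ℂ 1 = 1 := by simp [RCLike.map_apply]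
  have finj : Function.Injective (RCLike.map 𝕜 ℂ) := by
    intro x y h
    have h1 := congrArg Complex.re h
    have h2 := congrArg Complex.im h
    simp [RCLike.map_apply] at h1 h2
    exact RCLike.ext h1 h2
  constructor
  · intro hQ
    have key : ∀ (k : Fin d) (i j : Fin (m k)) (t : Fin (n k)) (x : StateIdx n m),
        (∀ s, x = ⟨k, (i, s)⟩ → Q x ⟨k, (i, t)⟩ = Q ⟨k, (j, s)⟩ ⟨k, (j, t)⟩) ∧
        ((∀ s, x ≠ ⟨k, (i, s)⟩) → Q x ⟨k, (i, t)⟩ = 0) := by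
      intro k i j t x
      set δ : (l : Fin d) → Matrix (Fin (m l)) (Fin (m l)) ℂ := fun l => Matrix.of fun a b =>
        if (⟨l, a⟩ : (l : Fin d) × Fin (m l)) = ⟨k, i⟩ ∧
          (⟨l, b⟩ : (l : Fin d) × Fin (m l)) = ⟨k, j⟩ then 1 else 0 with hδ
      have hΔ : ∀ x y : StateIdx n m, uncertaintyBlock n m δ x y =
          if ∃ s, x = ⟨k, (i, s)⟩ ∧ y = ⟨k, (j, s)⟩ then 1 else 0 := by
        rintro ⟨l, a, s⟩ ⟨l', b, s'⟩
        by_cases hl : l = l'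
        · subst hl
          simp only [uncertaintyBlock, Matrix.blockDiagonal'_apply_eq, Matrix.kroneckerMap_apply,
            hδ, Matrix.of_apply, Matrix.one_apply]
          by_cases hk : l = k
          · subst hk
            simp only [Sigma.mk.injEq, heq_eq_eq, true_and, Prod.mk.injEq]
            split_ifs <;> simp_all
          · simp [hk]
        · rw [uncertaintyBlock, Matrix.blockDiagonal'_apply_ne _ _ _ hl, if_neg]
          rintro ⟨s, h1, h2⟩
          exact hl ((congrArg Sigma.fst h1).trans (congrArg Sigma.fst h2).symm)
      have h := congrFun (congrFun (hQ _ ⟨δ, rfl⟩) x) ⟨k, (j, t)⟩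
      simp only [Matrix.mul_apply, hΔ, Matrix.map_apply] at h
      rw [Finset.sum_eq_single (⟨k, (i, t)⟩ : StateIdx n m)] at h
      rotate_left
      · rintro y - hy
        rw [if_neg, mul_zero]
        rintro ⟨s, h1, h2⟩
        apply hy
        simp only [Sigma.mk.injEq, heq_eq_eq, true_and, Prod.mk.injEq] at h2
        rw [h1, h2]
      · simp
      rw [if_pos ⟨t, rfl, rfl⟩, mul_one] at h
      constructor
      · rintro s rfl
        rw [Finset.sum_eq_single (⟨k, (j, s)⟩ : StateIdx n m)] at h
        · rw [if_pos ⟨s, rfl, rfl⟩, one_mul] at h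
          exact finj h
        · rintro y - hy
          rw [if_neg, zero_mul]
          rintro ⟨s', h1, h2⟩
          apply hy
          simp only [Sigma.mk.injEq, heq_eq_eq, true_and, Prod.mk.injEq] at h1
          rw [h2, h1]
        · simp
      · intro hx
        rw [Finset.sum_eq_zero] at h
        · exact finj (h.trans f0.symm)
        · rintro y -
          rw [if_neg, zero_mul]
          rintro ⟨s', h1, -⟩
          exact hx s' h1
    refine ⟨fun k => Matrix.of fun s t =>
      if h : 0 < m k then Q ⟨k, (⟨0, h⟩, s)⟩ ⟨k, (⟨0, h⟩, t)⟩ else 0, ?_⟩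
    ext ⟨l, a, s⟩ ⟨k, i, t⟩
    by_cases hl : l = k
    · subst hl
      have hpos : 0 < m l := i.pos
      by_cases ha : a = i
      · subst ha
        rw [(key l a ⟨0, hpos⟩ t _).1 s rfl]
        simp [Matrix.blockDiagonal'_apply_eq, hpos]
      · rw [(key l i i t _).2 (by simp [ha])]
        simp [Matrix.blockDiagonal'_apply_eq, ha]
    · rw [(key k i i t _).2 (by simp [hl]), Matrix.blockDiagonal'_apply_ne _ _ _ hl]
  · rintro ⟨Q₀, rfl⟩ _ ⟨δ, rfl⟩
    have hmap : ((Matrix.blockDiagonal' fun k =>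
        (1 : Matrix (Fin (m k)) (Fin (m k)) 𝕜) ⊗ₖ Q₀ k).map (RCLike.map 𝕜 ℂ)) =
        Matrix.blockDiagonal' fun k =>
          (1 : Matrix (Fin (m k)) (Fin (m k)) ℂ) ⊗ₖ (Q₀ k).map (RCLike.map 𝕜 ℂ) := by
      rw [Matrix.blockDiagonal'_map _ _ f0]
      congr 1
      funext k
      ext ⟨a, s⟩ ⟨b, t⟩
      by_cases hab : a = b
      · simp [hab]
      · simp [hab]
    rw [hmap, uncertaintyBlock, ← Matrix.blockDiagonal'_mul, ← Matrix.blockDiagonal'_mul]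
    congr 1
    funext k
    rw [← Matrix.mul_kronecker_mul, ← Matrix.mul_kronecker_mul]
    simp

/-! With `W = Q Qᴴ`, `𝓠`-stability becomes a Lyapunov condition: some positive definite `W` in the
commutant satisfies `W - A W Aᴴ > 0`, or, by Schur complements, `W⁻¹ - Aᴴ W⁻¹ A > 0`. To return from
`W` to `Q` one must factor inside the commutant, which is possible because its elements are block
diagonal with blocks `1 ⊗ W₀ k`.

Necessity: test both closed-loop inequalities on vectors `(x, 0)`. If `B₂ᴴ x = 0`, the controller
disappears from `A_clᴴ (x, 0)`; if `C₂ x = 0`, it disappears from `A_cl (x, 0)`. What remains are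
inequalities for the plant corners of `W` and of `W⁻¹`. Without controller states these corners are
inverse to each other, hence a single `X` in (1); in general two independent matrices are kept, as
in (2). Finsler's lemma trades positivity on a kernel for a term `B₂ B₂ᴴ` or `C₂ᴴ C₂`.

Sufficiency: in (1) an explicit gain works, the new Lyapunov matrix being a sum of positive terms
(`elimination_identity`). In (2) the two inequalities give separately a state feedback and, by
duality, an output injection; the resulting observer-based loop is block triangular in the
coordinates state and estimation error. A nonzero `D₂₂` is compensated inside the observer, and in
the static case by slightly rescaling the gain. -/

section LinearAlgebra

/-! ### Finsler's lemma, Schur complements and explicit stabilizing gains -/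

variable {𝕜 ι κ : Type*} [RCLike 𝕜] [Fintype ι] [Fintype κ]

theorem Matrix.IsHermitian.posDef_of_re_pos {M : Matrix ι ι 𝕜} (hM : M.IsHermitian)
    (h : ∀ x, x ≠ 0 → 0 < RCLike.re (star x ⬝ᵥ M *ᵥ x)) : M.PosDef :=
  .of_dotProduct_mulVec_pos hM fun x hx =>
    RCLike.pos_iff.2 ⟨h x hx, hM.im_star_dotProduct_mulVec_self x⟩

theorem re_star_dotProduct_self_nonneg (x : κ → 𝕜) : 0 ≤ RCLike.re (star x ⬝ᵥ x) := by
  classical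
  simpa using (Matrix.PosSemidef.one (n := κ) (R := 𝕜)).re_dotProduct_nonneg x

theorem re_star_dotProduct_self_pos {x : κ → 𝕜} (hx : x ≠ 0) : 0 < RCLike.re (star x ⬝ᵥ x) := by
  classical
  simpa using (Matrix.PosDef.one (n := κ) (R := 𝕜)).re_dotProduct_pos hx

theorem Matrix.star_dotProduct_mul_conjTranspose_mulVec (B : Matrix ι κ 𝕜) (x : ι → 𝕜) :
    star x ⬝ᵥ (B * Bᴴ) *ᵥ x = star (Bᴴ *ᵥ x) ⬝ᵥ (Bᴴ *ᵥ x) := by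
  rw [star_mulVec, conjTranspose_conjTranspose, ← dotProduct_mulVec, mulVec_mulVec]

/-- Finsler's lemma, strict version. -/
theorem Matrix.IsHermitian.exists_posDef_add_smul {M : Matrix ι ι 𝕜} (hM : M.IsHermitian)
    (B : Matrix ι κ 𝕜)
    (h : ∀ x, x ≠ 0 → Bᴴ *ᵥ x = 0 → 0 < RCLike.re (star x ⬝ᵥ M *ᵥ x)) :
    ∃ t : ℝ, 0 < t ∧ (M + t • (B * Bᴴ)).PosDef := by
  have hval (t : ℝ) (x : ι → 𝕜) : RCLike.re (star x ⬝ᵥ (M + t • (B * Bᴴ)) *ᵥ x) =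
      RCLike.re (star x ⬝ᵥ M *ᵥ x) + t * RCLike.re (star (Bᴴ *ᵥ x) ⬝ᵥ (Bᴴ *ᵥ x)) := by
    rw [add_mulVec, smul_mulVec, dotProduct_add, dotProduct_smul,
      star_dotProduct_mul_conjTranspose_mulVec, map_add, RCLike.smul_re]
  -- The open sets where the form with multiplier `k + 1` is positive increase with `k` and cover
  -- the unit sphere, so by compactness one of them contains it; homogeneity then gives all `x ≠ 0`.
  obtain ⟨k, hk⟩ := (isCompact_sphere (0 : ι → 𝕜) 1).elim_directed_cover
    (fun k : ℕ => {x | 0 < RCLike.re (star x ⬝ᵥ (M + ((k : ℝ) + 1) • (B * Bᴴ)) *ᵥ x)})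
    (fun k => isOpen_lt continuous_const <| by fun_prop) (by
      intro x hx
      have hx0 : x ≠ 0 := by rintro rfl; simp at hx
      simp only [Set.mem_iUnion, Set.mem_ofPred_eq, hval]
      by_cases hB : Bᴴ *ᵥ x = 0
      · exact ⟨0, by simpa [hB] using h x hx0 hB⟩
      · have hp := re_star_dotProduct_self_pos hB
        obtain ⟨k, hk⟩ := exists_nat_gt
          (-RCLike.re (star x ⬝ᵥ M *ᵥ x) / RCLike.re (star (Bᴴ *ᵥ x) ⬝ᵥ (Bᴴ *ᵥ x)))
        rw [div_lt_iff₀ hp] at hk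
        exact ⟨k, by linarith⟩)
    (directed_of_isDirected_le fun i j hij x hx => by
      simp only [Set.mem_ofPred_eq, hval] at hx ⊢
      have hn := re_star_dotProduct_self_nonneg (Bᴴ *ᵥ x)
      have hij' : (i : ℝ) ≤ j := by exact_mod_cast hij
      nlinarith)
  refine ⟨k + 1, by positivity, IsHermitian.posDef_of_re_pos ?_ fun x hx => ?_⟩
  · exact hM.add (IsSelfAdjoint.smul (IsSelfAdjoint.all _) (isHermitian_mul_conjTranspose_self B))
  · have hn : ‖x‖ ≠ 0 := norm_ne_zero_iff.2 hx
    have := hk (show ((‖x‖⁻¹ : ℝ) : 𝕜) • x ∈ Metric.sphere 0 1 by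
      simp [norm_smul, hn])
    simp only [Set.mem_ofPred_eq, mulVec_smul, star_smul, smul_dotProduct, dotProduct_smul,
      smul_eq_mul, RCLike.star_def, RCLike.conj_ofReal, RCLike.re_ofReal_mul] at this
    have hi : 0 < ‖x‖⁻¹ := by positivity
    exact pos_of_mul_pos_right (pos_of_mul_pos_right this hi.le) hi.le

variable [DecidableEq ι]

theorem Matrix.PosDef.mul_inv_cancel {X : Matrix ι ι 𝕜} (hX : X.PosDef) : X * X⁻¹ = 1 :=
  X.mul_nonsing_inv ((X.isUnit_iff_isUnit_det).1 hX.isUnit)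

theorem Matrix.PosDef.inv_mul_cancel {X : Matrix ι ι 𝕜} (hX : X.PosDef) : X⁻¹ * X = 1 :=
  X.nonsing_inv_mul ((X.isUnit_iff_isUnit_det).1 hX.isUnit)

/-- The two Schur complements of `[W A; Aᴴ V⁻¹]` are positive definite together. -/
theorem Matrix.PosDef.inv_sub_conjTranspose_mul_inv_mul {W V A : Matrix ι ι 𝕜} (hV : V.PosDef)
    (h : (W - A * V * Aᴴ).PosDef) : (V⁻¹ - Aᴴ * W⁻¹ * A).PosDef := by
  have hW : W.PosDef := by
    have := h.add_posSemidef (hV.posSemidef.mul_mul_conjTranspose_same A)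
    simpa using this
  set M := W - A * V * Aᴴ with hMdef
  have hP : (V + V * Aᴴ * M⁻¹ * A * V).PosDef := by
    refine hV.add_posSemidef ?_
    have := h.inv.posSemidef.mul_mul_conjTranspose_same (V * Aᴴ)
    simpa [conjTranspose_mul, hV.1.eq, Matrix.mul_assoc] using this
  -- Woodbury's formula: the matrix in `hP` is the inverse of the Schur complement in question.
  suffices e : (V⁻¹ - Aᴴ * W⁻¹ * A) * (V + V * Aᴴ * M⁻¹ * A * V) = 1 by
    rw [← inv_eq_left_inv e]
    exact hP.inv
  have hAVA : A * V * Aᴴ = W - M := by simp [hMdef]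
  have e1 : V⁻¹ * V = 1 := hV.inv_mul_cancel
  have e2 : W⁻¹ * W = 1 := hW.inv_mul_cancel
  have e3 : M * M⁻¹ = 1 := h.mul_inv_cancel
  calc (V⁻¹ - Aᴴ * W⁻¹ * A) * (V + V * Aᴴ * M⁻¹ * A * V)
      = V⁻¹ * V + V⁻¹ * V * Aᴴ * M⁻¹ * A * V - Aᴴ * W⁻¹ * A * V
        - Aᴴ * W⁻¹ * (A * V * Aᴴ) * M⁻¹ * A * V := by noncomm_ring
    _ = 1 + Aᴴ * M⁻¹ * A * V - Aᴴ * W⁻¹ * A * V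
        - Aᴴ * (W⁻¹ * W) * M⁻¹ * A * V + Aᴴ * W⁻¹ * (M * M⁻¹) * A * V := by
          rw [hAVA, e1]; noncomm_ring
    _ = 1 := by rw [e2, e3]; noncomm_ring

/-- The quadratic form of `1 - Tᴴ T` is `‖x‖² - ‖T x‖²`. The norm bound is strict because `‖T x‖`
attains its maximum on the compact unit sphere. -/
theorem Matrix.norm_toEuclideanCLM_lt_one_iff (T : Matrix ι ι 𝕜) :
    ‖Matrix.toEuclideanCLM (𝕜 := 𝕜) (n := ι) T‖ < 1 ↔ (1 - Tᴴ * T).PosDef := by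
  have hval (x : ι → 𝕜) : RCLike.re (star x ⬝ᵥ (1 - Tᴴ * T) *ᵥ x) =
      ‖WithLp.toLp 2 x‖ ^ 2 - ‖toEuclideanCLM (𝕜 := 𝕜) (n := ι) T (WithLp.toLp 2 x)‖ ^ 2 := by
    have h1 := star_dotProduct_mul_conjTranspose_mulVec Tᴴ x
    rw [conjTranspose_conjTranspose] at h1
    rw [sub_mulVec, dotProduct_sub, h1, map_sub, one_mulVec, toEuclideanCLM_toLp,
      ← inner_self_eq_norm_sq (𝕜 := 𝕜), ← inner_self_eq_norm_sq (𝕜 := 𝕜),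
      EuclideanSpace.inner_toLp_toLp, EuclideanSpace.inner_toLp_toLp, dotProduct_comm,
      dotProduct_comm (star (T *ᵥ x))]
  constructor
  · intro h
    refine IsHermitian.posDef_of_re_pos
      (isHermitian_one.sub (isHermitian_conjTranspose_mul_self T)) fun x hx => ?_
    rw [hval]
    have hx' : 0 < ‖WithLp.toLp 2 x‖ := by
      rw [norm_pos_iff]; intro h0; exact hx (by simpa using h0)
    have := (toEuclideanCLM (𝕜 := 𝕜) (n := ι) T).le_opNorm (WithLp.toLp 2 x)
    have h2 : ‖toEuclideanCLM (𝕜 := 𝕜) (n := ι) T (WithLp.toLp 2 x)‖ < ‖WithLp.toLp 2 x‖ := by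
      nlinarith
    have := norm_nonneg (toEuclideanCLM (𝕜 := 𝕜) (n := ι) T (WithLp.toLp 2 x))
    nlinarith
  · intro h
    set L := toEuclideanCLM (𝕜 := 𝕜) (n := ι) T
    -- The sphere is empty exactly when the space is zero, and then the norm is `0`.
    rcases (Metric.sphere (0 : EuclideanSpace 𝕜 ι) 1).eq_empty_or_nonempty with he | hne
    · have : L = 0 := by
        ext1 x
        by_contra hx
        have hx0 : x ≠ 0 := by rintro rfl; simp at hx
        have hn : ‖x‖ ≠ 0 := norm_ne_zero_iff.2 hx0
        have : ((‖x‖⁻¹ : ℝ) : 𝕜) • x ∈ Metric.sphere (0 : EuclideanSpace 𝕜 ι) 1 := by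
          simp [norm_smul, hn]
        simp [he] at this
      simp [this]
    · obtain ⟨x, hx, hmax⟩ := (isCompact_sphere (0 : EuclideanSpace 𝕜 ι) 1).exists_isMaxOn hne
        (f := fun x => ‖L x‖) (by fun_prop)
      have hx1 : ‖x‖ = 1 := by simpa using hx
      have hx0 : x ≠ 0 := by rintro rfl; simp at hx1
      have hlt : ‖L x‖ < 1 := by
        have := h.re_dotProduct_pos (x := WithLp.ofLp x) (by simpa using hx0)
        rw [hval, WithLp.toLp_ofLp, hx1] at this
        have h0 := norm_nonneg (L x)
        change 0 < 1 ^ 2 - ‖L x‖ ^ 2 at this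
        nlinarith
      refine lt_of_le_of_lt (L.opNorm_le_bound (norm_nonneg _) fun y => ?_) hlt
      by_cases hy : y = 0
      · simp [hy]
      · have hn : 0 < ‖y‖ := norm_pos_iff.2 hy
        have := hmax (show ((‖y‖⁻¹ : ℝ) : 𝕜) • y ∈ Metric.sphere 0 1 by
          simp [norm_smul, hn.ne'])
        simp only [Set.mem_ofPred_eq, map_smul, norm_smul, RCLike.norm_ofReal, abs_inv,
          abs_norm] at this
        rw [inv_mul_le_iff₀ hn] at this
        linarith

theorem Matrix.norm_toEuclideanCLM_lt_one_iff' (T : Matrix ι ι 𝕜) :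
    ‖Matrix.toEuclideanCLM (𝕜 := 𝕜) (n := ι) T‖ < 1 ↔ (1 - T * Tᴴ).PosDef := by
  have := norm_toEuclideanCLM_lt_one_iff Tᴴ
  rwa [← star_eq_conjTranspose T, map_star, ContinuousLinearMap.star_eq_adjoint,
    LinearIsometryEquiv.norm_map, star_eq_conjTranspose, conjTranspose_conjTranspose] at this

/-- State feedback: an explicit stabilizing gain. -/
theorem Matrix.exists_stateFeedback {Y : Matrix ι ι 𝕜} (hY : Y.PosDef) (A : Matrix ι ι 𝕜)
    (B : Matrix ι κ 𝕜) (h : (Y + B * Bᴴ - A * Y * Aᴴ).PosDef) :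
    ∃ F : Matrix κ ι 𝕜, (Y⁻¹ - (A + B * F)ᴴ * Y⁻¹ * (A + B * F)).PosDef := by
  have hZ : (Y + B * Bᴴ).PosDef := hY.add_posSemidef (posSemidef_self_mul_conjTranspose B)
  have hH := hY.inv_sub_conjTranspose_mul_inv_mul h
  set Z := Y + B * Bᴴ with hZdef
  have e : A + B * (-(Bᴴ * Z⁻¹ * A)) = Y * Z⁻¹ * A := by
    have : Y = Z - B * Bᴴ := by simp [hZdef]
    rw [this, sub_mul, sub_mul, hZ.mul_inv_cancel]
    simp [Matrix.mul_assoc, sub_eq_add_neg]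
  refine ⟨-(Bᴴ * Z⁻¹ * A), ?_⟩
  -- With `F = -Bᴴ Z⁻¹ A` the closed-loop Lyapunov matrix equals `(Y⁻¹ - Aᴴ Z⁻¹ A) + Fᴴ F`.
  have hq := hH.add_posSemidef (posSemidef_conjTranspose_mul_self (Bᴴ * Z⁻¹ * A))
  convert hq using 1
  rw [e]
  simp only [conjTranspose_mul, hY.1.eq, hZ.1.inv.eq, conjTranspose_conjTranspose]
  have h1 : Aᴴ * (Z⁻¹ * Y) * Y⁻¹ * (Y * Z⁻¹ * A) = Aᴴ * Z⁻¹ * (Y * Y⁻¹) * Y * Z⁻¹ * A := by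
    noncomm_ring
  have h2 : Aᴴ * (Z⁻¹ * B) * (Bᴴ * Z⁻¹ * A) = Aᴴ * Z⁻¹ * (B * Bᴴ) * Z⁻¹ * A := by
    simp only [Matrix.mul_assoc]
  have h3 : Aᴴ * Z⁻¹ * A = Aᴴ * (Z⁻¹ * Z) * Z⁻¹ * A := by rw [hZ.inv_mul_cancel, mul_one]
  rw [h1, h2, h3, hY.mul_inv_cancel, hZdef]
  noncomm_ring

/-- Completion of squares behind the static gain, to be read with `X = Y⁻¹`, `S = B Bᴴ`, `T = Cᴴ C`,
primes as adjoints, `A = (Y + S) G`, and closed-loop matrix `Y G + S G J`. Each of the four summands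
on the right is then visibly positive semidefinite, the first even definite. Only ring operations
enter. -/
theorem elimination_identity {R : Type*} [Ring R] {X Y S T G G' J J' H : R} (hXY : X * Y = 1)
    (hYX : Y * X = 1) (hH : X = H + G' * (Y + S) * G) (hJ : (H + T) * J = H)
    (hJ' : J' * (H + T) = H) :
    X - (G' * Y + J' * G' * S) * X * (Y * G + S * G * J) =
      J' * (X + T - G' * (Y + S) * X * (Y + S) * G) * J + (1 - J') * H * (1 - J) + J' * T * J +
        (1 - J') * G' * S * G * (1 - J) := by
  have e1 : (G' * Y + J' * G' * S) * X * (Y * G + S * G * J) =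
      G' * Y * G + G' * S * G * J + J' * G' * S * G + J' * G' * S * X * S * G * J := by
    calc _ = G' * (Y * X) * Y * G + G' * (Y * X) * S * G * J + J' * G' * S * (X * Y) * G
          + J' * G' * S * X * S * G * J := by noncomm_ring
      _ = _ := by rw [hXY, hYX]; noncomm_ring
  have e2 : G' * (Y + S) * X * (Y + S) * G =
      G' * (Y + S + S) * G + G' * S * X * S * G := by
    calc _ = G' * (Y * X) * Y * G + G' * (Y * X) * S * G + G' * S * (X * Y) * G
          + G' * S * X * S * G := by noncomm_ring
      _ = _ := by rw [hXY, hYX]; noncomm_ring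
  rw [e1, e2]
  have e3 : J' * (G' * S * X * S * G) * J = J' * G' * S * X * S * G * J := by noncomm_ring
  have k1 : J' * H * J + J' * T * J = J' * H := by
    rw [mul_assoc, mul_assoc, ← mul_add, ← add_mul, hJ]
  have k2 : J' * H * J + J' * T * J = H * J := by rw [← add_mul, ← mul_add, hJ']
  rw [mul_sub, sub_mul, mul_add, add_mul, mul_add, add_mul, e3]
  generalize J' * G' * S * X * S * G * J = q
  subst hH
  rw [← sub_eq_zero]
  calc _ = -(J' * H * J + J' * T * J - J' * H) - (J' * H * J + J' * T * J - H * J) := by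
        noncomm_ring
    _ = 0 := by rw [sub_eq_zero.2 k1, sub_eq_zero.2 k2]; simp

/-- The elimination lemma for static output feedback, with both multipliers normalized. -/
theorem Matrix.exists_outputFeedback {κ' : Type*} [Fintype κ'] {Y : Matrix ι ι 𝕜} (hY : Y.PosDef)
    (A : Matrix ι ι 𝕜) (B : Matrix ι κ 𝕜) (C : Matrix κ' ι 𝕜)
    (hB : (Y + B * Bᴴ - A * Y * Aᴴ).PosDef) (hC : (Y⁻¹ + Cᴴ * C - Aᴴ * Y⁻¹ * A).PosDef) :
    ∃ K : Matrix κ κ' 𝕜, (Y⁻¹ - (A + B * K * C)ᴴ * Y⁻¹ * (A + B * K * C)).PosDef := by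
  have hZ : (Y + B * Bᴴ).PosDef := hY.add_posSemidef (posSemidef_self_mul_conjTranspose B)
  have hH := hY.inv_sub_conjTranspose_mul_inv_mul hB
  set Z := Y + B * Bᴴ with hZdef
  set H := Y⁻¹ - Aᴴ * Z⁻¹ * A with hHdef
  have hN : (H + Cᴴ * C).PosDef := hH.add_posSemidef (posSemidef_conjTranspose_mul_self C)
  set N := H + Cᴴ * C with hNdef
  set G := Z⁻¹ * A with hG
  set J := N⁻¹ * H with hJdef
  have hA : A = Z * G := by rw [hG, ← mul_assoc, hZ.mul_inv_cancel, one_mul]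
  have hA' : Aᴴ = Gᴴ * Z := by rw [hA, conjTranspose_mul, hZ.1.eq]
  have hJ : N * J = H := by rw [hJdef, ← mul_assoc, hN.mul_inv_cancel, one_mul]
  have hJ' : Jᴴ * N = H := by
    rw [← hN.1.eq, ← conjTranspose_mul, hJ, hH.1.eq]
  -- The state feedback `-Bᴴ G` is applied to the estimate `N⁻¹ Cᴴ (C x)`, a least squares estimate
  -- of `x` from `C x` regularized by `H`. Since `N⁻¹ Cᴴ C = 1 - J`, the error left over is `J x`.
  refine ⟨-(Bᴴ * G * N⁻¹ * Cᴴ), ?_⟩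
  have e : A + B * -(Bᴴ * G * N⁻¹ * Cᴴ) * C = Y * G + B * Bᴴ * G * J := by
    have e1 : B * -(Bᴴ * G * N⁻¹ * Cᴴ) * C = -(B * Bᴴ * G * (N⁻¹ * (Cᴴ * C))) := by
      simp only [Matrix.mul_neg, Matrix.neg_mul, Matrix.mul_assoc]
    have e2 : N⁻¹ * (Cᴴ * C) = 1 - J := by
      have : Cᴴ * C = N - H := by simp [hNdef]
      rw [this, mul_sub, hN.inv_mul_cancel]
    rw [e1, e2, hA, hZdef]
    noncomm_ring
  have e' : (A + B * -(Bᴴ * G * N⁻¹ * Cᴴ) * C)ᴴ = Gᴴ * Y + Jᴴ * Gᴴ * (B * Bᴴ) := by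
    rw [e]
    simp [conjTranspose_mul, hY.1.eq, Matrix.mul_assoc]
  have hX : Y⁻¹ = H + Gᴴ * Z * G := by
    rw [← hA', hG, ← mul_assoc, hHdef]; simp
  rw [e', e, elimination_identity hY.inv_mul_cancel hY.mul_inv_cancel hX hJ hJ']
  have hPd : (Y⁻¹ + Cᴴ * C - Gᴴ * (Y + B * Bᴴ) * Y⁻¹ * (Y + B * Bᴴ) * G).PosDef := by
    rw [← hZdef, ← hA', mul_assoc, ← hA]; exact hC
  -- Invertibility of `J` makes the first summand strictly positive.
  have hJu : IsUnit J := IsUnit.mul hN.inv.isUnit hH.isUnit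
  clear_value J G N H Z
  clear e e' hB hC hA hA' hG hX
  refine PosDef.add_posSemidef (PosDef.add_posSemidef (PosDef.add_posSemidef ?_ ?_) ?_) ?_
  · exact hPd.conjTranspose_mul_mul_same (mulVec_injective_iff_isUnit.2 hJu)
  · have := hH.posSemidef.conjTranspose_mul_mul_same (1 - J)
    rwa [conjTranspose_sub, conjTranspose_one] at this
  · exact (posSemidef_conjTranspose_mul_self C).conjTranspose_mul_mul_same J
  · have := (posSemidef_self_mul_conjTranspose B).conjTranspose_mul_mul_same (G * (1 - J))
    rw [conjTranspose_mul, conjTranspose_sub, conjTranspose_one] at this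
    simpa only [← mul_assoc] using this

end LinearAlgebra

/-! ### Algebra of the commutant and factorization inside it -/

section Commutant

variable {𝕜 : Type*} [RCLike 𝕜]

/-- The inclusion of `𝕜` in `ℂ` as a ring homomorphism. -/
noncomputable def RCLike.complexRingHom (𝕜 : Type*) [RCLike 𝕜] : 𝕜 →+* ℂ where
  toFun := RCLike.map 𝕜 ℂ
  map_zero' := map_zero _
  map_add' := map_add _
  map_one' := by simp [RCLike.map_apply]
  map_mul' x y := by
    apply Complex.ext <;> simp [RCLike.map_apply]

theorem Matrix.map_rclikeMap_mul {l m n : Type*} [Fintype m] (A : Matrix l m 𝕜) (B : Matrix m n 𝕜) :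
    (A * B).map (RCLike.map 𝕜 ℂ) = A.map (RCLike.map 𝕜 ℂ) * B.map (RCLike.map 𝕜 ℂ) :=
  Matrix.map_mul (f := RCLike.complexRingHom 𝕜)

theorem Matrix.map_rclikeMap_one {n : Type*} [DecidableEq n] :
    (1 : Matrix n n 𝕜).map (RCLike.map 𝕜 ℂ) = 1 :=
  Matrix.map_one _ (map_zero (RCLike.complexRingHom 𝕜)) (map_one (RCLike.complexRingHom 𝕜))

theorem Matrix.map_rclikeMap_conjTranspose {m n : Type*} (A : Matrix m n 𝕜) :
    Aᴴ.map (RCLike.map 𝕜 ℂ) = (A.map (RCLike.map 𝕜 ℂ))ᴴ := by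
  ext i j
  apply Complex.ext <;> simp [RCLike.map_apply]

variable {ι : Type*} [Fintype ι] {S : Set (Matrix ι ι ℂ)}

theorem one_mem_commutant [DecidableEq ι] : (1 : Matrix ι ι 𝕜) ∈ commutant 𝕜 S := fun Δ _ => by
  rw [Matrix.map_rclikeMap_one, one_mul, mul_one]

theorem mul_mem_commutant {A B : Matrix ι ι 𝕜} (hA : A ∈ commutant 𝕜 S) (hB : B ∈ commutant 𝕜 S) :
    A * B ∈ commutant 𝕜 S := fun Δ hΔ => by
  rw [Matrix.map_rclikeMap_mul, mul_assoc, hB Δ hΔ, ← mul_assoc, hA Δ hΔ, mul_assoc]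

theorem smul_mem_commutant {A : Matrix ι ι 𝕜} (c : 𝕜) (hA : A ∈ commutant 𝕜 S) :
    c • A ∈ commutant 𝕜 S := fun Δ hΔ => by
  have : (c • A).map (RCLike.map 𝕜 ℂ) = RCLike.map 𝕜 ℂ c • A.map (RCLike.map 𝕜 ℂ) := by
    ext i j
    exact map_mul (RCLike.complexRingHom 𝕜) c (A i j)
  rw [this, Matrix.smul_mul, Matrix.mul_smul, hA Δ hΔ]

theorem inv_mem_commutant [DecidableEq ι] {A : Matrix ι ι 𝕜} (hA : A ∈ commutant 𝕜 S) (hu : IsUnit A) :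
    A⁻¹ ∈ commutant 𝕜 S := fun Δ hΔ => by
  have hd := (A.isUnit_iff_isUnit_det).1 hu
  have h1 : A⁻¹.map (RCLike.map 𝕜 ℂ) * A.map (RCLike.map 𝕜 ℂ) = 1 := by
    rw [← Matrix.map_rclikeMap_mul, A.nonsing_inv_mul hd, Matrix.map_rclikeMap_one]
  have h2 : A.map (RCLike.map 𝕜 ℂ) * A⁻¹.map (RCLike.map 𝕜 ℂ) = 1 := by
    rw [← Matrix.map_rclikeMap_mul, A.mul_nonsing_inv hd, Matrix.map_rclikeMap_one]
  calc A⁻¹.map (RCLike.map 𝕜 ℂ) * Δ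
      = A⁻¹.map (RCLike.map 𝕜 ℂ) * (Δ * A.map (RCLike.map 𝕜 ℂ)) * A⁻¹.map (RCLike.map 𝕜 ℂ) := by
        rw [mul_assoc, mul_assoc, h2, mul_one]
    _ = Δ * A⁻¹.map (RCLike.map 𝕜 ℂ) := by
        rw [← hA Δ hΔ, ← mul_assoc, h1, one_mul]

theorem conjTranspose_mem_commutant (hS : ∀ Δ ∈ S, Δᴴ ∈ S) {A : Matrix ι ι 𝕜}
    (hA : A ∈ commutant 𝕜 S) : Aᴴ ∈ commutant 𝕜 S := fun Δ hΔ => by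
  have := congrArg Matrix.conjTranspose (hA _ (hS Δ hΔ))
  rw [Matrix.conjTranspose_mul, Matrix.conjTranspose_mul, Matrix.conjTranspose_conjTranspose] at this
  rw [Matrix.map_rclikeMap_conjTranspose, this]

variable {d : ℕ} {n nK m : Fin d → ℕ}

theorem conjTranspose_uncertaintyBlock (n : Fin d → ℕ)
    (δ : (k : Fin d) → Matrix (Fin (m k)) (Fin (m k)) ℂ) :
    (uncertaintyBlock n m δ)ᴴ = uncertaintyBlock n m fun k => (δ k)ᴴ := by
  simp [uncertaintyBlock, Matrix.blockDiagonal'_conjTranspose, Matrix.conjTranspose_kronecker]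

theorem conjTranspose_mem_coupledStructure :
    ∀ Δ ∈ coupledStructure n nK m, Δᴴ ∈ coupledStructure n nK m := by
  rintro _ ⟨δ, rfl⟩
  exact ⟨fun k => (δ k)ᴴ, by
    simp [Matrix.fromBlocks_conjTranspose, conjTranspose_uncertaintyBlock]⟩

/-- The coupled `Δ` is block diagonal, so commutation splits into four intertwining relations. The
off-diagonal ones link plant and controller multiplicities. -/
theorem fromBlocks_mem_commutant_coupledStructure_iff
    {a : Matrix (StateIdx n m) (StateIdx n m) 𝕜} {b : Matrix (StateIdx n m) (StateIdx nK m) 𝕜}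
    {c : Matrix (StateIdx nK m) (StateIdx n m) 𝕜} {e : Matrix (StateIdx nK m) (StateIdx nK m) 𝕜} :
    Matrix.fromBlocks a b c e ∈ commutant 𝕜 (coupledStructure n nK m) ↔
      ∀ δ, a.map (RCLike.map 𝕜 ℂ) * uncertaintyBlock n m δ =
          uncertaintyBlock n m δ * a.map (RCLike.map 𝕜 ℂ) ∧
        b.map (RCLike.map 𝕜 ℂ) * uncertaintyBlock nK m δ =
          uncertaintyBlock n m δ * b.map (RCLike.map 𝕜 ℂ) ∧
        c.map (RCLike.map 𝕜 ℂ) * uncertaintyBlock n m δ =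
          uncertaintyBlock nK m δ * c.map (RCLike.map 𝕜 ℂ) ∧
        e.map (RCLike.map 𝕜 ℂ) * uncertaintyBlock nK m δ =
          uncertaintyBlock nK m δ * e.map (RCLike.map 𝕜 ℂ) := by
  simp only [commutant, coupledStructure, Set.forall_mem_range, Set.mem_ofPred_eq,
    Matrix.fromBlocks_map, Matrix.fromBlocks_multiply, Matrix.fromBlocks_inj, Matrix.mul_zero,
    Matrix.zero_mul, add_zero, zero_add]

theorem mem_commutant_uncertaintyStructure {a : Matrix (StateIdx n m) (StateIdx n m) 𝕜} :
    a ∈ commutant 𝕜 (uncertaintyStructure n m) ↔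
      ∀ δ, a.map (RCLike.map 𝕜 ℂ) * uncertaintyBlock n m δ =
        uncertaintyBlock n m δ * a.map (RCLike.map 𝕜 ℂ) := by
  simp only [commutant, uncertaintyStructure, Set.forall_mem_range, Set.mem_ofPred_eq]

theorem toBlocks₁₁_mem_commutant
    {W : Matrix (StateIdx n m ⊕ StateIdx nK m) (StateIdx n m ⊕ StateIdx nK m) 𝕜}
    (hW : W ∈ commutant 𝕜 (coupledStructure n nK m)) :
    W.toBlocks₁₁ ∈ commutant 𝕜 (uncertaintyStructure n m) := by
  rw [← W.fromBlocks_toBlocks, fromBlocks_mem_commutant_coupledStructure_iff] at hW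
  exact mem_commutant_uncertaintyStructure.2 fun δ => (hW δ).1

theorem fromBlocks_diagonal_mem_commutant {a : Matrix (StateIdx n m) (StateIdx n m) 𝕜}
    {e : Matrix (StateIdx nK m) (StateIdx nK m) 𝕜}
    (ha : a ∈ commutant 𝕜 (uncertaintyStructure n m))
    (he : e ∈ commutant 𝕜 (uncertaintyStructure nK m)) :
    Matrix.fromBlocks a 0 0 e ∈ commutant 𝕜 (coupledStructure n nK m) := by
  rw [fromBlocks_mem_commutant_coupledStructure_iff]
  rw [mem_commutant_uncertaintyStructure] at ha he
  exact fun δ => ⟨ha δ, by simp, by simp,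
    he δ⟩

open scoped MatrixOrder in
/-- Positive definite elements of the commutant factor inside the commutant. -/
theorem exists_mul_conjTranspose_eq_of_mem_commutant {W : Matrix (StateIdx n m) (StateIdx n m) 𝕜}
    (hW : W ∈ commutant 𝕜 (uncertaintyStructure n m)) (hp : W.PosDef) :
    ∃ Q ∈ commutant 𝕜 (uncertaintyStructure n m), Q * Qᴴ = W := by
  obtain ⟨W₀, rfl⟩ := (mem_commutant_uncertaintyStructure_iff n m W).1 hW
  have hfac (k : Fin d) : ∃ Q : Matrix (Fin (n k)) (Fin (n k)) 𝕜, 0 < m k → Q * Qᴴ = W₀ k := by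
    -- If `m k = 0`, the block `W₀ k` does not occur in `W` and need not be positive; any `Q` will
    -- do.
    by_cases hk : 0 < m k
    · have hk' : (W₀ k).PosSemidef := by
        have := hp.posSemidef.submatrix fun i : Fin (n k) =>
          (⟨k, (⟨0, hk⟩, i)⟩ : StateIdx n m)
        convert this using 1
        ext i j
        simp [Matrix.blockDiagonal'_apply_eq]
      obtain ⟨Q, hQ⟩ := CStarAlgebra.nonneg_iff_eq_mul_star_self.1 hk'.nonneg
      exact ⟨Q, fun _ => hQ.symm⟩
    · exact ⟨0, fun h => absurd h hk⟩
  choose Q₀ hQ₀ using hfac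
  refine ⟨_, (mem_commutant_uncertaintyStructure_iff n m _).2 ⟨Q₀, rfl⟩, ?_⟩
  rw [Matrix.blockDiagonal'_conjTranspose, ← Matrix.blockDiagonal'_mul]
  congr 1
  funext k
  rw [Matrix.conjTranspose_kronecker, ← Matrix.mul_kronecker_mul, Matrix.conjTranspose_one, one_mul]
  by_cases hk : 0 < m k
  · rw [hQ₀ k hk]
  · ext ⟨a, i⟩
    exact absurd a.pos hk

end Commutant

/-! ### `𝓠`-stability as a Lyapunov inequality -/

section Stability

theorem Matrix.PosDef.fromBlocks_diagonal {𝕜 ι κ : Type*} [RCLike 𝕜] [Fintype ι] [Fintype κ] {M : Matrix ι ι 𝕜}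
    {N : Matrix κ κ 𝕜} (hM : M.PosDef) (hN : N.PosDef) : (Matrix.fromBlocks M 0 0 N).PosDef := by
  refine IsHermitian.posDef_of_re_pos (hM.1.fromBlocks (by simp) hN.1) fun x hx => ?_
  have e : star x ⬝ᵥ (fromBlocks M 0 0 N) *ᵥ x =
      star (x ∘ Sum.inl) ⬝ᵥ M *ᵥ (x ∘ Sum.inl) + star (x ∘ Sum.inr) ⬝ᵥ N *ᵥ (x ∘ Sum.inr) := by
    conv_lhs => rw [← Sum.elim_comp_inl_inr x]
    rw [fromBlocks_mulVec, Function.star_sumElim, sumElim_dotProduct_sumElim]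
    simp
  rw [e, map_add]
  have h1 := hM.posSemidef.re_dotProduct_nonneg (x ∘ Sum.inl)
  have h2 := hN.posSemidef.re_dotProduct_nonneg (x ∘ Sum.inr)
  by_cases hl : x ∘ Sum.inl = 0
  · have hr : x ∘ Sum.inr ≠ 0 := by
      intro hr
      apply hx
      rw [← Sum.elim_comp_inl_inr x, hl, hr]
      simp
    have := hN.re_dotProduct_pos hr
    linarith
  · have := hM.re_dotProduct_pos hl
    linarith

variable {𝕜 : Type*} [RCLike 𝕜] {ι : Type*} [Fintype ι] [DecidableEq ι]
  {S : Set (Matrix ι ι ℂ)} {A : Matrix ι ι 𝕜}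

/-- Take `W = Q Qᴴ` and conjugate `1 - T Tᴴ > 0` by `Q`, where `T = Q⁻¹ A Q`. Closure of `S` under
adjoints keeps `W` in the commutant. -/
theorem IsQStable.exists_posDef (hS : ∀ Δ ∈ S, Δᴴ ∈ S) (h : IsQStable A S) :
    ∃ W ∈ commutant 𝕜 S, W.PosDef ∧ (W - A * W * Aᴴ).PosDef := by
  obtain ⟨Q, hQ, hu, hn⟩ := h
  rw [Matrix.norm_toEuclideanCLM_lt_one_iff'] at hn
  have hinj : Function.Injective Q.vecMul := Matrix.vecMul_injective_iff_isUnit.2 hu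
  refine ⟨Q * Qᴴ, mul_mem_commutant hQ (conjTranspose_mem_commutant hS hQ),
    Matrix.PosDef.mul_conjTranspose_self Q hinj, ?_⟩
  have e : Q * (Q⁻¹ * A * Q) = A * Q := by
    rw [← mul_assoc, ← mul_assoc, Q.mul_nonsing_inv ((Q.isUnit_iff_isUnit_det).1 hu), one_mul]
  have := hn.mul_mul_conjTranspose_same hinj
  convert this using 1
  have e' : (Q⁻¹ * A * Q)ᴴ * Qᴴ = Qᴴ * Aᴴ := by
    rw [← Matrix.conjTranspose_mul, e, Matrix.conjTranspose_mul]
  calc _ = Q * Qᴴ - A * Q * (Qᴴ * Aᴴ) := by simp only [mul_assoc]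
    _ = _ := by
      rw [← e, ← e']
      noncomm_ring

theorem isQStable_of_mul_conjTranspose {Q : Matrix ι ι 𝕜} (hQ : Q ∈ commutant 𝕜 S)
    (hp : (Q * Qᴴ).PosDef) (h : (Q * Qᴴ - A * (Q * Qᴴ) * Aᴴ).PosDef) : IsQStable A S := by
  have hu : IsUnit Q := isUnit_of_mul_isUnit_left hp.isUnit
  have hd := (Q.isUnit_iff_isUnit_det).1 hu
  refine ⟨Q, hQ, hu, (Matrix.norm_toEuclideanCLM_lt_one_iff' _).2 ?_⟩
  have hinj : Function.Injective (Q⁻¹).vecMul :=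
    Matrix.vecMul_injective_iff_isUnit.2 ((Matrix.isUnit_nonsing_inv_iff).2 hu)
  have := h.mul_mul_conjTranspose_same hinj
  convert this using 1
  have e : Qᴴ * (Q⁻¹)ᴴ = 1 := by
    rw [← Matrix.conjTranspose_mul, Q.nonsing_inv_mul hd, Matrix.conjTranspose_one]
  have e1 : Q⁻¹ * (Q * Qᴴ) * (Q⁻¹)ᴴ = 1 := by
    rw [← mul_assoc, Q.nonsing_inv_mul hd, one_mul, e]
  rw [mul_sub, sub_mul, e1, Matrix.conjTranspose_mul, Matrix.conjTranspose_mul]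
  simp only [mul_assoc]

theorem IsQStable.conj {P : Matrix ι ι 𝕜} (h : IsQStable A S) (hP : P ∈ commutant 𝕜 S)
    (hu : IsUnit P) : IsQStable (P * A * P⁻¹) S := by
  obtain ⟨Q, hQ, huQ, hn⟩ := h
  refine ⟨P * Q, mul_mem_commutant hP hQ, hu.mul huQ, ?_⟩
  have e := P.nonsing_inv_mul ((P.isUnit_iff_isUnit_det).1 hu)
  have : (P * Q)⁻¹ * (P * A * P⁻¹) * (P * Q) = Q⁻¹ * A * Q := by
    rw [Matrix.mul_inv_rev]
    calc _ = Q⁻¹ * (P⁻¹ * P) * A * (P⁻¹ * P) * Q := by noncomm_ring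
      _ = _ := by rw [e, mul_one, mul_one]
  rwa [this]

/-- A block triangular matrix with `𝓠`-stable diagonal blocks is `𝓠`-stable. -/
theorem IsQStable.fromBlocks_triangular {d : ℕ} {n nK m : Fin d → ℕ}
    {A₁ : Matrix (StateIdx n m) (StateIdx n m) 𝕜} {A₂ : Matrix (StateIdx nK m) (StateIdx nK m) 𝕜}
    (h₁ : IsQStable A₁ (uncertaintyStructure n m)) (h₂ : IsQStable A₂ (uncertaintyStructure nK m))
    (G : Matrix (StateIdx n m) (StateIdx nK m) 𝕜) :
    IsQStable (Matrix.fromBlocks A₁ G 0 A₂) (coupledStructure n nK m) := by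
  obtain ⟨Q₁, hQ₁, hu₁, hn₁⟩ := h₁
  obtain ⟨Q₂, hQ₂, hu₂, hn₂⟩ := h₂
  -- Scaling `Q₂` by `c` multiplies the off-diagonal block by `c`. At `c = 0` the norm is below `1`,
  -- so by continuity some small `c ≠ 0` also works.
  let L : 𝕜 → Matrix (StateIdx n m ⊕ StateIdx nK m) (StateIdx n m ⊕ StateIdx nK m) 𝕜 := fun c =>
    Matrix.fromBlocks (Q₁⁻¹ * A₁ * Q₁) (c • (Q₁⁻¹ * G * Q₂)) 0 (Q₂⁻¹ * A₂ * Q₂)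
  let f : 𝕜 → ℝ := fun c => ‖Matrix.toEuclideanCLM (𝕜 := 𝕜) (L c)‖
  have hf : Continuous f := by
    have hL : Continuous L :=
      Continuous.matrix_fromBlocks continuous_const (by fun_prop) continuous_const continuous_const
    exact ((LinearMap.continuous_of_finiteDimensional
      (Matrix.toEuclideanCLM (𝕜 := 𝕜)
        (n := StateIdx n m ⊕ StateIdx nK m)).toAlgEquiv.toLinearMap).comp hL).norm
  have hf0 : f 0 < 1 := by
    rw [Matrix.norm_toEuclideanCLM_lt_one_iff] at hn₁ hn₂
    refine (Matrix.norm_toEuclideanCLM_lt_one_iff _).2 ?_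
    have := hn₁.fromBlocks_diagonal hn₂
    convert this using 1
    simp only [L, zero_smul, Matrix.fromBlocks_conjTranspose, Matrix.fromBlocks_multiply,
      ← Matrix.fromBlocks_one, Matrix.conjTranspose_zero, Matrix.mul_zero, Matrix.zero_mul,
      add_zero, zero_add, sub_eq_add_neg, Matrix.fromBlocks_neg, Matrix.fromBlocks_add, neg_zero]
  obtain ⟨c, hc1, hc0⟩ := (((hf.tendsto 0).eventually_lt_const hf0).filter_mono
    nhdsWithin_le_nhds |>.and (self_mem_nhdsWithin (s := {0}ᶜ))).exists
  replace hc0 : c ≠ 0 := hc0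
  have e₁ := Q₁.mul_nonsing_inv ((Q₁.isUnit_iff_isUnit_det).1 hu₁)
  have e₂ := Q₂.mul_nonsing_inv ((Q₂.isUnit_iff_isUnit_det).1 hu₂)
  have e : Matrix.fromBlocks Q₁ 0 0 (c • Q₂) * Matrix.fromBlocks Q₁⁻¹ 0 0 (c⁻¹ • Q₂⁻¹) = 1 := by
    simp [Matrix.fromBlocks_multiply, e₁, e₂, smul_smul, hc0]
  refine ⟨Matrix.fromBlocks Q₁ 0 0 (c • Q₂),
    fromBlocks_diagonal_mem_commutant hQ₁ (smul_mem_commutant c hQ₂),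
    isUnit_of_mul_isUnit_left (e ▸ isUnit_one), ?_⟩
  have hL : (Matrix.fromBlocks Q₁ 0 0 (c • Q₂))⁻¹ * Matrix.fromBlocks A₁ G 0 A₂ *
      Matrix.fromBlocks Q₁ 0 0 (c • Q₂) = L c := by
    rw [Matrix.inv_eq_right_inv e]
    simp [L, Matrix.fromBlocks_multiply, smul_smul, hc0]
  rw [hL]
  exact hc1

end Stability

/-! ### The closed-loop state matrix and construction of controllers -/

section ClosedLoop

variable {𝕜 : Type*} [RCLike 𝕜] {d : ℕ} {n nK m : Fin d → ℕ} {u₁ u₂ y₁ y₂ : ℕ}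

theorem Matrix.isUnit_one_sub_mul_comm {R m n : Type*} [CommRing R] [Fintype m] [Fintype n]
    [DecidableEq m] [DecidableEq n] (A : Matrix m n R) (B : Matrix n m R) :
    IsUnit (1 - A * B) ↔ IsUnit (1 - B * A) := by
  rw [isUnit_iff_isUnit_det, isUnit_iff_isUnit_det, det_one_sub_mul_comm]

namespace LFTPlant

/-- The feedthrough `D₂₂` only reparametrizes the controller: the loop has the shape it would have
for `D₂₂ = 0`, with modified controller matrices. -/
theorem closedLoopA_eq (P : LFTPlant 𝕜 n m u₁ u₂ y₁ y₂) (K : LFTController 𝕜 nK m u₂ y₂)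
    (h : P.WellPosed K) :
    P.closedLoopA K = Matrix.fromBlocks (P.A + P.B₂ * ((1 - K.D * P.D₂₂)⁻¹ * K.D) * P.C₂)
      (P.B₂ * ((1 - K.D * P.D₂₂)⁻¹ * K.C))
      ((K.B + K.B * P.D₂₂ * (1 - K.D * P.D₂₂)⁻¹ * K.D) * P.C₂)
      (K.A + K.B * P.D₂₂ * (1 - K.D * P.D₂₂)⁻¹ * K.C) := by
  have hu : IsUnit (1 - K.D * P.D₂₂) := (Matrix.isUnit_one_sub_mul_comm _ _).1 h
  have hE := Matrix.mul_nonsing_inv _ ((Matrix.isUnit_iff_isUnit_det _).1 hu)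
  set E := (1 - K.D * P.D₂₂)⁻¹
  have h1 : 1 - Matrix.fromBlocks K.A K.B K.C K.D * (Matrix.fromBlocks 0 0 0 P.D₂₂ :
        Matrix (StateIdx nK m ⊕ Fin y₂) (StateIdx nK m ⊕ Fin u₂) 𝕜) =
      Matrix.fromBlocks 1 (-(K.B * P.D₂₂)) 0 (1 - K.D * P.D₂₂) := by
    simp [Matrix.fromBlocks_multiply, ← Matrix.fromBlocks_one, sub_eq_add_neg,
      Matrix.fromBlocks_neg, Matrix.fromBlocks_add]
  have h2 : (1 - Matrix.fromBlocks K.A K.B K.C K.D * (Matrix.fromBlocks 0 0 0 P.D₂₂ :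
        Matrix (StateIdx nK m ⊕ Fin y₂) (StateIdx nK m ⊕ Fin u₂) 𝕜))⁻¹ =
      Matrix.fromBlocks 1 (K.B * P.D₂₂ * E) 0 E := by
    refine Matrix.inv_eq_right_inv ?_
    rw [h1, Matrix.fromBlocks_multiply, hE]
    simp [← Matrix.fromBlocks_one]
  have h3 : P.closedLoopA K = Matrix.fromBlocks P.A 0 0 0 +
      (Matrix.fromBlocks 0 P.B₂ 1 0 : Matrix (StateIdx n m ⊕ StateIdx nK m)
        (StateIdx nK m ⊕ Fin u₂) 𝕜) *
      (Matrix.fromBlocks 1 (K.B * P.D₂₂ * E) 0 E : Matrix (StateIdx nK m ⊕ Fin u₂)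
        (StateIdx nK m ⊕ Fin u₂) 𝕜) * Matrix.fromBlocks K.A K.B K.C K.D *
      (Matrix.fromBlocks 0 1 P.C₂ 0 : Matrix (StateIdx nK m ⊕ Fin y₂)
        (StateIdx n m ⊕ StateIdx nK m) 𝕜) := by
    rw [closedLoopA, closedLoop, lowerLFT, h2, Matrix.fromRows_mul, Matrix.fromRows_mul]
    ext i j
    simp [Matrix.toBlocks₁₁]
  rw [h3]
  simp only [Matrix.fromBlocks_multiply, Matrix.fromBlocks_add, Matrix.zero_mul, Matrix.mul_zero,
    Matrix.one_mul, Matrix.mul_one, add_zero, zero_add, Matrix.mul_assoc]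

/-- The restrictions of the closed-loop Lyapunov inequalities to the plant state. -/
theorem IsQStabilizedBy.exists_lyapunov {P : LFTPlant 𝕜 n m u₁ u₂ y₁ y₂}
    {K : LFTController 𝕜 nK m u₂ y₂} (h : P.IsQStabilizedBy K) :
    ∃ W ∈ commutant 𝕜 (coupledStructure n nK m), W.PosDef ∧
      (∀ x, x ≠ 0 → P.B₂ᴴ *ᵥ x = 0 →
        0 < RCLike.re (star x ⬝ᵥ (W.toBlocks₁₁ - P.A * W.toBlocks₁₁ * P.Aᴴ) *ᵥ x)) ∧
      (∀ x, x ≠ 0 → P.C₂ *ᵥ x = 0 →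
        0 < RCLike.re (star x ⬝ᵥ (W⁻¹.toBlocks₁₁ - P.Aᴴ * W⁻¹.toBlocks₁₁ * P.A) *ᵥ x)) := by
  obtain ⟨hw, hs⟩ := h
  rw [closedLoopA_eq P K hw] at hs
  generalize (1 - K.D * P.D₂₂)⁻¹ * K.D = a at hs
  generalize (1 - K.D * P.D₂₂)⁻¹ * K.C = b at hs
  generalize K.B + K.B * P.D₂₂ * (1 - K.D * P.D₂₂)⁻¹ * K.D = c at hs
  generalize K.A + K.B * P.D₂₂ * (1 - K.D * P.D₂₂)⁻¹ * K.C = e at hs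
  obtain ⟨W, hW, hp, hL⟩ := hs.exists_posDef conjTranspose_mem_coupledStructure
  have hL' := hp.inv_sub_conjTranspose_mul_inv_mul hL
  -- If `F` maps `(x, 0)` to `(F₀ x, 0)`, the form of `V - Fᴴ V F` at `(x, 0)` sees only the plant
  -- corner of `V`.
  have hblock (V : Matrix (StateIdx n m ⊕ StateIdx nK m) (StateIdx n m ⊕ StateIdx nK m) 𝕜)
      (F : Matrix (StateIdx n m ⊕ StateIdx nK m) (StateIdx n m ⊕ StateIdx nK m) 𝕜)
      (F₀ : Matrix (StateIdx n m) (StateIdx n m) 𝕜) (x : StateIdx n m → 𝕜)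
      (hF : F *ᵥ Sum.elim x 0 = Sum.elim (F₀ *ᵥ x) 0) :
      star (Sum.elim x 0) ⬝ᵥ (V - Fᴴ * V * F) *ᵥ Sum.elim x 0 =
        star x ⬝ᵥ (V.toBlocks₁₁ - F₀ᴴ * V.toBlocks₁₁ * F₀) *ᵥ x := by
    have h1 (y : StateIdx n m → 𝕜) : star (Sum.elim y (0 : StateIdx nK m → 𝕜)) ⬝ᵥ
        V *ᵥ Sum.elim y 0 = star y ⬝ᵥ V.toBlocks₁₁ *ᵥ y := by
      conv_lhs => rw [← V.fromBlocks_toBlocks]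
      rw [Matrix.fromBlocks_mulVec, Function.star_sumElim, sumElim_dotProduct_sumElim]
      simp
    have h2 {ι : Type _} [Fintype ι] (V F : Matrix ι ι 𝕜) (x : ι → 𝕜) :
        star x ⬝ᵥ (Fᴴ * V * F) *ᵥ x = star (F *ᵥ x) ⬝ᵥ V *ᵥ (F *ᵥ x) := by
      rw [Matrix.star_mulVec, ← Matrix.dotProduct_mulVec, Matrix.mulVec_mulVec,
        Matrix.mulVec_mulVec, mul_assoc]
    rw [Matrix.sub_mulVec, Matrix.sub_mulVec, dotProduct_sub, dotProduct_sub, h2, h2, hF, h1, h1]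
  have hne {x : StateIdx n m → 𝕜} (hx : x ≠ 0) : Sum.elim x (0 : StateIdx nK m → 𝕜) ≠ 0 :=
    fun h => hx (funext fun i => congrFun h (Sum.inl i))
  refine ⟨W, hW, hp, fun x hx hB => ?_, fun x hx hC => ?_⟩
  · have := hL.re_dotProduct_pos (hne hx)
    have hb := hblock W (Matrix.fromBlocks (P.A + P.B₂ * a * P.C₂) (P.B₂ * b) (c * P.C₂) e)ᴴ
      P.Aᴴ x (by
        rw [Matrix.fromBlocks_conjTranspose, Matrix.fromBlocks_mulVec]
        simp [Matrix.add_mulVec, Matrix.conjTranspose_mul, ← Matrix.mulVec_mulVec, hB])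
    rw [Matrix.conjTranspose_conjTranspose, Matrix.conjTranspose_conjTranspose] at hb
    rwa [hb] at this
  · have := hL'.re_dotProduct_pos (hne hx)
    rwa [hblock W⁻¹ _ P.A x (by
        rw [Matrix.fromBlocks_mulVec]
        simp [Matrix.add_mulVec, ← Matrix.mulVec_mulVec, hC])] at this

/-- The observer-based controller built from a state feedback and an output injection. -/
theorem exists_isQStabilizedBy_of_feedback (P : LFTPlant 𝕜 n m u₁ u₂ y₁ y₂)
    (F : Matrix (Fin u₂) (StateIdx n m) 𝕜) (L : Matrix (StateIdx n m) (Fin y₂) 𝕜)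
    (hF : IsQStable (P.A + P.B₂ * F) (uncertaintyStructure n m))
    (hL : IsQStable (P.A + L * P.C₂) (uncertaintyStructure n m)) :
    ∃ K : LFTController 𝕜 n m u₂ y₂, P.IsQStabilizedBy K := by
  -- Observer with zero feedthrough; the term `L D₂₂ F` cancels the contribution of `D₂₂` to the
  -- loop.
  let K : LFTController 𝕜 n m u₂ y₂ :=
    ⟨P.A + P.B₂ * F + L * P.C₂ + L * P.D₂₂ * F, -L, F, 0⟩
  have hw : P.WellPosed K := by simp [WellPosed, K]
  refine ⟨K, hw, ?_⟩
  -- The involution `(x, x_K) ↦ (x, x - x_K)` passes to the estimation error, where the loop is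
  -- block triangular with diagonal blocks `A + B₂ F` and `A + L C₂`.
  let S : Matrix (StateIdx n m ⊕ StateIdx n m) (StateIdx n m ⊕ StateIdx n m) 𝕜 :=
    Matrix.fromBlocks 1 0 1 (-1)
  have hSS : S * S = 1 := by simp [S, Matrix.fromBlocks_multiply]
  have hS : S ∈ commutant 𝕜 (coupledStructure n n m) := by
    have h1 := mem_commutant_uncertaintyStructure.1
      (one_mem_commutant (𝕜 := 𝕜) (S := uncertaintyStructure n m))
    have h2 := mem_commutant_uncertaintyStructure.1
      (smul_mem_commutant (𝕜 := 𝕜) (-1) (one_mem_commutant (S := uncertaintyStructure n m)))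
    rw [neg_one_smul] at h2
    exact fromBlocks_mem_commutant_coupledStructure_iff.2 fun δ =>
      ⟨h1 δ, by simp, h1 δ, h2 δ⟩
  have := (hF.fromBlocks_triangular hL (-(P.B₂ * F))).conj hS (isUnit_of_mul_isUnit_left
    (hSS ▸ isUnit_one))
  rw [Matrix.inv_eq_right_inv hSS] at this
  convert this using 1
  rw [closedLoopA_eq P K hw]
  simp only [K, S, Matrix.fromBlocks_multiply, Matrix.zero_mul, Matrix.mul_zero, sub_zero, inv_one,
    Matrix.one_mul, Matrix.mul_one, add_zero, zero_add, Matrix.neg_mul, Matrix.mul_neg]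
  congr 1 <;> abel

/-- A stabilizing static gain for the plant with `D₂₂` removed can be perturbed so that the loop
around the original plant is well posed. -/
theorem exists_static_isQStabilizedBy (P : LFTPlant 𝕜 n m u₁ u₂ y₁ y₂)
    (K₀ : Matrix (Fin u₂) (Fin y₂) 𝕜)
    (h : IsQStable (P.A + P.B₂ * K₀ * P.C₂) (uncertaintyStructure n m)) :
    ∃ K : LFTController 𝕜 (fun _ : Fin d => 0) m u₂ y₂, P.IsQStabilizedBy K := by
  obtain ⟨Q, hQ, hu, hn⟩ := h
  have hf : Continuous fun τ : 𝕜 => ‖Matrix.toEuclideanCLM (𝕜 := 𝕜) (n := StateIdx n m)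
      (Q⁻¹ * (P.A + P.B₂ * (τ • K₀) * P.C₂) * Q)‖ :=
    ((LinearMap.continuous_of_finiteDimensional (Matrix.toEuclideanCLM (𝕜 := 𝕜)
      (n := StateIdx n m)).toAlgEquiv.toLinearMap).comp (by fun_prop)).norm
  -- Stability persists for infinitely many `τ` near `1`, while `det (1 + τ K₀ D₂₂)` is a polynomial
  -- in `τ` with value `1` at `0`, so it has finitely many zeros.
  have hinf := infinite_of_mem_nhds (1 : 𝕜) ((hf.tendsto 1).eventually_lt_const (by simpa using hn))
  have hne : (-(K₀ * P.D₂₂)).charpolyRev ≠ 0 := fun h0 => by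
    simpa [h0] using (-(K₀ * P.D₂₂)).eval_charpolyRev
  obtain ⟨τ, hτ, hroot⟩ := hinf.exists_notMem_finset (-(K₀ * P.D₂₂)).charpolyRev.roots.toFinset
  replace hτ : ‖Matrix.toEuclideanCLM (𝕜 := 𝕜) (n := StateIdx n m)
      (Q⁻¹ * (P.A + P.B₂ * (τ • K₀) * P.C₂) * Q)‖ < 1 := hτ
  have hdet : IsUnit (1 + τ • K₀ * P.D₂₂) := by
    rw [Matrix.isUnit_iff_isUnit_det, isUnit_iff_ne_zero]
    intro h0
    apply hroot
    rw [Multiset.mem_toFinset, Polynomial.mem_roots hne, Polynomial.IsRoot, Matrix.charpolyRev,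
      ← Polynomial.coe_evalRingHom, RingHom.map_det, ← h0]
    congr 1
    ext i j
    simp [Matrix.one_apply, apply_ite, mul_comm τ]
  set K₁ := τ • K₀
  have hd := (Matrix.isUnit_iff_isUnit_det _).1 hdet
  have h1 : 1 - (1 + K₁ * P.D₂₂)⁻¹ * K₁ * P.D₂₂ = (1 + K₁ * P.D₂₂)⁻¹ := by
    have e := Matrix.nonsing_inv_mul _ hd
    rw [mul_add, mul_one, ← Matrix.mul_assoc] at e
    rw [sub_eq_iff_eq_add, e]
  -- This feedthrough solves `(1 - D_K D₂₂)⁻¹ D_K = K₁`.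
  let K : LFTController 𝕜 (fun _ : Fin d => 0) m u₂ y₂ := ⟨0, 0, 0, (1 + K₁ * P.D₂₂)⁻¹ * K₁⟩
  have hw : P.WellPosed K := by
    rw [WellPosed, Matrix.isUnit_one_sub_mul_comm, h1]
    exact (Matrix.isUnit_nonsing_inv_iff).2 hdet
  refine ⟨K, hw, ?_⟩
  have h2 : (1 - K.D * P.D₂₂)⁻¹ * K.D = K₁ := by
    rw [show K.D = (1 + K₁ * P.D₂₂)⁻¹ * K₁ from rfl, h1, Matrix.nonsing_inv_nonsing_inv _ hd,
      Matrix.mul_nonsing_inv_cancel_left _ _ hd]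
  have h₁ : IsQStable (P.A + P.B₂ * K₁ * P.C₂) (uncertaintyStructure n m) := ⟨Q, hQ, hu, hτ⟩
  have h₂ : IsQStable (0 : Matrix (StateIdx (fun _ : Fin d => 0) m) (StateIdx _ m) 𝕜)
      (uncertaintyStructure (fun _ : Fin d => 0) m) :=
    ⟨1, one_mem_commutant, isUnit_one, by simp⟩
  convert h₁.fromBlocks_triangular h₂ 0 using 1
  rw [closedLoopA_eq P K hw, h2]
  simp [K]

end LFTPlant

end ClosedLoop

/-! ### From matrix inequalities to stabilizing gains -/

section Synthesis

variable {𝕜 : Type*} [RCLike 𝕜] {d : ℕ} {n m : Fin d → ℕ}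

theorem Matrix.posDef_conjTranspose_mul_mul_iff_of_range_eq_ker {ι κ κ' : Type*} [Fintype ι]
    [Fintype κ] [Fintype κ'] {B : Matrix ι κ 𝕜} {N : Matrix κ' ι 𝕜} {M : Matrix ι ι 𝕜}
    (hM : M.IsHermitian) (hB : Function.Injective B.mulVecLin)
    (hr : LinearMap.range B.mulVecLin = LinearMap.ker N.mulVecLin) :
    (Bᴴ * M * B).PosDef ↔
      ∀ x, x ≠ 0 → N *ᵥ x = 0 → 0 < RCLike.re (star x ⬝ᵥ M *ᵥ x) := by
  have e (y : κ → 𝕜) : star y ⬝ᵥ (Bᴴ * M * B) *ᵥ y = star (B *ᵥ y) ⬝ᵥ M *ᵥ (B *ᵥ y) := by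
    rw [star_mulVec, ← dotProduct_mulVec, mulVec_mulVec, mulVec_mulVec, Matrix.mul_assoc]
  constructor
  · intro h x hx hN
    obtain ⟨y, rfl⟩ : x ∈ LinearMap.range B.mulVecLin := by rw [hr]; exact hN
    rw [mulVecLin_apply, ← e]
    exact h.re_dotProduct_pos (by rintro rfl; simp at hx)
  · intro h
    refine IsHermitian.posDef_of_re_pos (isHermitian_conjTranspose_mul_mul _ hM) fun y hy => ?_
    rw [e]
    refine h _ (fun h0 => hy (hB (by simpa using h0))) ?_
    have : B.mulVecLin y ∈ LinearMap.ker N.mulVecLin := hr ▸ LinearMap.mem_range_self _ y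
    exact this

theorem Matrix.sqrt_smul_mul_conjTranspose {ι κ : Type*} [Fintype κ] {t : ℝ} (ht : 0 < t)
    (B : Matrix ι κ 𝕜) :
    (Real.sqrt t • B) * (Real.sqrt t • B)ᴴ = t • (B * Bᴴ) := by
  rw [conjTranspose_smul, star_trivial, Matrix.smul_mul, Matrix.mul_smul, smul_smul,
    Real.mul_self_sqrt ht.le]

/-- The Schur complement lemma turns the inequality for `X` into the dual one for `X⁻¹`, which is
then factored as `Q Qᴴ` inside the commutant. -/
theorem isQStable_of_posDef {A X : Matrix (StateIdx n m) (StateIdx n m) 𝕜}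
    (hX : X ∈ commutant 𝕜 (uncertaintyStructure n m)) (hp : X.PosDef)
    (h : (X - Aᴴ * X * A).PosDef) : IsQStable A (uncertaintyStructure n m) := by
  have h' := hp.inv_sub_conjTranspose_mul_inv_mul (W := X) (A := Aᴴ) (by simpa using h)
  obtain ⟨Q, hQ, hW⟩ :=
    exists_mul_conjTranspose_eq_of_mem_commutant (inv_mem_commutant hX hp.isUnit) hp.inv
  refine isQStable_of_mul_conjTranspose hQ (hW ▸ hp.inv) ?_
  rw [hW]
  simpa using h'

theorem IsQStable.of_conjTranspose {A : Matrix (StateIdx n m) (StateIdx n m) 𝕜}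
    (h : IsQStable Aᴴ (uncertaintyStructure n m)) : IsQStable A (uncertaintyStructure n m) := by
  obtain ⟨W, hW, hp, hL⟩ := h.exists_posDef (by
    rintro _ ⟨δ, rfl⟩
    exact ⟨_, (conjTranspose_uncertaintyBlock n δ).symm⟩)
  exact isQStable_of_posDef hW hp (by simpa using hL)

theorem exists_feedback_isQStable {κ : Type*} [Fintype κ]
    {A Y : Matrix (StateIdx n m) (StateIdx n m) 𝕜} {B : Matrix (StateIdx n m) κ 𝕜}
    (hY : Y ∈ commutant 𝕜 (uncertaintyStructure n m)) (hp : Y.PosDef)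
    (h : (-(A * Y * Aᴴ - Y - B * Bᴴ)).PosDef) :
    ∃ F : Matrix κ (StateIdx n m) 𝕜, IsQStable (A + B * F) (uncertaintyStructure n m) := by
  obtain ⟨F, hF⟩ := Matrix.exists_stateFeedback hp A B (by convert h using 1; abel)
  exact ⟨F, isQStable_of_posDef (inv_mem_commutant hY hp.isUnit) hp.inv hF⟩

/-- Finsler's lemma for a Stein inequality, with the multiplier absorbed by homogeneity. -/
theorem exists_stein_of_pos_on_ker {κ : Type*} [Fintype κ]
    {A Y : Matrix (StateIdx n m) (StateIdx n m) 𝕜} {B : Matrix (StateIdx n m) κ 𝕜}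
    (hY : Y ∈ commutant 𝕜 (uncertaintyStructure n m)) (hp : Y.PosDef)
    (h : ∀ x, x ≠ 0 → Bᴴ *ᵥ x = 0 → 0 < RCLike.re (star x ⬝ᵥ (Y - A * Y * Aᴴ) *ᵥ x)) :
    ∃ Y' ∈ commutant 𝕜 (uncertaintyStructure n m), Y'.PosDef ∧
      (-(A * Y' * Aᴴ - Y' - B * Bᴴ)).PosDef := by
  obtain ⟨t, ht, hF⟩ := (hp.1.sub (by
    simpa using Matrix.isHermitian_conjTranspose_mul_mul Aᴴ hp.1)).exists_posDef_add_smul B h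
  have e (M : Matrix (StateIdx n m) (StateIdx n m) 𝕜) : t⁻¹ • M = ((t⁻¹ : ℝ) : 𝕜) • M := by
    ext i j
    simp [RCLike.real_smul_eq_coe_mul]
  -- Dividing Finsler's inequality by `t` normalizes the coefficient of `B Bᴴ` to `1`.
  refine ⟨t⁻¹ • Y, e Y ▸ smul_mem_commutant _ hY, hp.smul (inv_pos.2 ht), ?_⟩
  convert hF.smul (inv_pos.2 ht) using 1
  rw [smul_add, smul_smul, inv_mul_cancel₀ ht.ne', smul_sub, Matrix.mul_smul, Matrix.smul_mul,
    one_smul]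
  abel

end Synthesis

/-! ### Static and dynamic synthesis -/

theorem theorem3p2 {𝕜 : Type*} [RCLike 𝕜] {d : ℕ} (n m : Fin d → ℕ) {u₁ u₂ y₁ y₂ : ℕ}
    (P : LFTPlant 𝕜 n m u₁ u₂ y₁ y₂) :
    -- (1) static output feedback: all controller multiplicities are zero
    (∀ (p q : ℕ) (Bperp : Matrix (StateIdx n m) (Fin p) 𝕜) (Cperp : Matrix (Fin q) (StateIdx n m) 𝕜),
      Function.Injective Bperp.mulVecLin →
      LinearMap.range Bperp.mulVecLin = LinearMap.ker P.B₂ᴴ.mulVecLin →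
      Function.Injective Cperpᴴ.mulVecLin →
      LinearMap.range Cperpᴴ.mulVecLin = LinearMap.ker P.C₂.mulVecLin →
      ((∃ K : LFTController 𝕜 (fun _ : Fin d => 0) m u₂ y₂, P.IsQStabilizedBy K) ↔
        ∃ X ∈ commutant 𝕜 (uncertaintyStructure n m), X.PosDef ∧
          (-(Bperpᴴ * P.A * X⁻¹ * P.Aᴴ * Bperp - Bperpᴴ * X⁻¹ * Bperp)).PosDef ∧
          (-(Cperp * P.Aᴴ * X * P.A * Cperpᴴ - Cperp * X * Cperpᴴ)).PosDef)) ∧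
    -- (2) dynamic output feedback with arbitrary controller multiplicities
    ((∃ (nK : Fin d → ℕ) (K : LFTController 𝕜 nK m u₂ y₂), P.IsQStabilizedBy K) ↔
      ∃ X ∈ commutant 𝕜 (uncertaintyStructure n m),
      ∃ Y ∈ commutant 𝕜 (uncertaintyStructure n m), X.PosDef ∧ Y.PosDef ∧
        (-(P.A * Y * P.Aᴴ - Y - P.B₂ * P.B₂ᴴ)).PosDef ∧
        (-(P.Aᴴ * X * P.A - X - P.C₂ᴴ * P.C₂)).PosDef) := by
  constructor
  · intro p q Bperp Cperp hBi hBr hCi hCr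
    have hHB {Y : Matrix (StateIdx n m) (StateIdx n m) 𝕜} (hY : Y.IsHermitian) :
        (Y - P.A * Y * P.Aᴴ).IsHermitian :=
      hY.sub (by simpa using Matrix.isHermitian_conjTranspose_mul_mul P.Aᴴ hY)
    have hHC {X : Matrix (StateIdx n m) (StateIdx n m) 𝕜} (hX : X.IsHermitian) :
        (X - P.Aᴴ * X * P.A).IsHermitian :=
      hX.sub (Matrix.isHermitian_conjTranspose_mul_mul P.A hX)
    have eB (Y : Matrix (StateIdx n m) (StateIdx n m) 𝕜) :
        -(Bperpᴴ * P.A * Y * P.Aᴴ * Bperp - Bperpᴴ * Y * Bperp) =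
          Bperpᴴ * (Y - P.A * Y * P.Aᴴ) * Bperp := by
      simp only [Matrix.mul_sub, Matrix.sub_mul, Matrix.mul_assoc, neg_sub]
    have eC (X : Matrix (StateIdx n m) (StateIdx n m) 𝕜) :
        -(Cperp * P.Aᴴ * X * P.A * Cperpᴴ - Cperp * X * Cperpᴴ) =
          Cperpᴴᴴ * (X - P.Aᴴ * X * P.A) * Cperpᴴ := by
      simp only [Matrix.mul_sub, Matrix.sub_mul, Matrix.mul_assoc, neg_sub,
        Matrix.conjTranspose_conjTranspose]
    constructor
    · rintro ⟨K, hK⟩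
      obtain ⟨W, hW, hp, hB, hC⟩ := hK.exists_lyapunov
      -- The controller state space is zero, so the two plant corners are mutually inverse. This
      -- couples the two inequalities through one `X`.
      have hmul : W.toBlocks₁₁ * W⁻¹.toBlocks₁₁ = 1 := by
        ext i j
        have := congrFun (congrFun hp.mul_inv_cancel (Sum.inl i)) (Sum.inl j)
        rw [Matrix.mul_apply, Fintype.sum_sum_type,
          Fintype.sum_eq_zero (α := StateIdx (fun _ : Fin d => 0) m) _ fun x => x.2.2.elim0,
          add_zero] at this
        simpa [Matrix.mul_apply, Matrix.one_apply, Matrix.toBlocks₁₁] using this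
      have hYp : W.toBlocks₁₁.PosDef := hp.submatrix Sum.inl_injective
      have hX : W.toBlocks₁₁⁻¹ = W⁻¹.toBlocks₁₁ := Matrix.inv_eq_right_inv hmul
      rw [← hX] at hC
      refine ⟨W.toBlocks₁₁⁻¹, inv_mem_commutant (toBlocks₁₁_mem_commutant hW) hYp.isUnit,
        hYp.inv, ?_, ?_⟩
      · rw [Matrix.nonsing_inv_nonsing_inv _ ((Matrix.isUnit_iff_isUnit_det _).1 hYp.isUnit), eB]
        exact (Matrix.posDef_conjTranspose_mul_mul_iff_of_range_eq_ker (hHB hYp.1) hBi hBr).2 hB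
      · rw [eC]
        exact (Matrix.posDef_conjTranspose_mul_mul_iff_of_range_eq_ker (hHC hYp.inv.1) hCi hCr).2 hC
    · rintro ⟨X, hX, hp, hB, hC⟩
      rw [eB, Matrix.posDef_conjTranspose_mul_mul_iff_of_range_eq_ker (hHB hp.inv.1) hBi hBr] at hB
      rw [eC, Matrix.posDef_conjTranspose_mul_mul_iff_of_range_eq_ker (hHC hp.1) hCi hCr] at hC
      obtain ⟨t, ht, hB⟩ := (hHB hp.inv.1).exists_posDef_add_smul P.B₂ hB
      obtain ⟨s, hs, hC⟩ := (hHC hp.1).exists_posDef_add_smul P.C₂ᴴ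
        (by simpa only [Matrix.conjTranspose_conjTranspose] using hC)
      -- The multipliers `t` and `s` cannot both be absorbed by rescaling `X`; they are moved into
      -- `B₂` and `C₂`, and finally into the gain.
      rw [← Matrix.sqrt_smul_mul_conjTranspose ht] at hB
      rw [← Matrix.sqrt_smul_mul_conjTranspose hs] at hC
      have hXX : X⁻¹⁻¹ = X :=
        Matrix.nonsing_inv_nonsing_inv _ ((Matrix.isUnit_iff_isUnit_det _).1 hp.isUnit)
      obtain ⟨K, hK⟩ := Matrix.exists_outputFeedback hp.inv P.A (Real.sqrt t • P.B₂)
        (Real.sqrt s • P.C₂) (by convert hB using 1; abel) (by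
          rw [hXX]
          convert hC using 1
          rw [Matrix.conjTranspose_smul, Matrix.conjTranspose_smul, star_trivial,
            Matrix.conjTranspose_conjTranspose]
          abel)
      have e : Real.sqrt t • P.B₂ * K * Real.sqrt s • P.C₂ =
          P.B₂ * (Real.sqrt t • Real.sqrt s • K) * P.C₂ := by
        simp only [Matrix.smul_mul, Matrix.mul_smul, smul_comm (Real.sqrt t)]
      rw [hXX, e] at hK
      exact P.exists_static_isQStabilizedBy (Real.sqrt t • Real.sqrt s • K)
        (isQStable_of_posDef hX hp hK)
  · constructor
    · rintro ⟨nK, K, hK⟩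
      obtain ⟨W, hW, hp, hB, hC⟩ := hK.exists_lyapunov
      have hinv := inv_mem_commutant hW hp.isUnit
      -- No relation between `X` and `Y` is required, so each corner may be rescaled separately.
      obtain ⟨Y, hY, hYp, hYL⟩ := exists_stein_of_pos_on_ker (toBlocks₁₁_mem_commutant hW)
        (hp.submatrix Sum.inl_injective) hB
      obtain ⟨X, hX, hXp, hXL⟩ := exists_stein_of_pos_on_ker (A := P.Aᴴ) (B := P.C₂ᴴ)
        (toBlocks₁₁_mem_commutant hinv) (hp.inv.submatrix Sum.inl_injective)
        (by simpa only [Matrix.conjTranspose_conjTranspose] using hC)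
      exact ⟨X, hX, Y, hY, hXp, hYp, hYL, by
        simpa only [Matrix.conjTranspose_conjTranspose] using hXL⟩
    · rintro ⟨X, hX, Y, hY, hXp, hYp, hYL, hXL⟩
      obtain ⟨F, hF⟩ := exists_feedback_isQStable hY hYp hYL
      obtain ⟨L, hL⟩ := exists_feedback_isQStable (A := P.Aᴴ) (B := P.C₂ᴴ) hX hXp
        (by simpa only [Matrix.conjTranspose_conjTranspose] using hXL)
      have e : P.Aᴴ + P.C₂ᴴ * L = (P.A + Lᴴ * P.C₂)ᴴ := by
        rw [Matrix.conjTranspose_add, Matrix.conjTranspose_mul, Matrix.conjTranspose_conjTranspose]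
      rw [e] at hL
      -- An observer copies the plant state, so the plant's own multiplicities suffice.
      exact ⟨n, P.exists_isQStabilizedBy_of_feedback F Lᴴ hF hL.of_conjTranspose⟩
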